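/- Let $n \ge 2$, and let $(A_1,B_1),\dots,(A_m,B_m)$ be a finite sequence of pairs of non-trivial (that is, non-zero) linear subspaces of the real vector space $V=\mathbb{R}^N$. Write $a_i=\dim A_i$ and $b_i=\dim B_i$, and suppose that $a_i+b_i=n$ for $1\le i\le m$. Suppose further that (i) $\dim(A_i\cap B_i)=0$ for $1\le i\le m$, and (ii) $\dim(A_i\cap B_j)>0$ for $1\le i,j\le m$ with $i\ne j$. Then $$\sum_{i=1}^m \frac{1}{\binom{n}{a_i}}\le 1.$$ -/

import Mathlib

open Finset Module
open scoped FinsetFamily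

/-! A generic projection to `ℝⁿ` is injective on every `A i ⊔ B i`. Let multivectors act by
contraction on functions of subsets of `Fin n`. Contracting the top element by a basis of `A i`
gives `p i`; contracting by a basis of `B i` is an operator `q i`. Then `q i (p j)` vanishes for `i
≠ j`, as `B i` meets `A j`, and is nonzero for `i = j`. Climb through the degrees `k`: contract the
current space in all directions, then adjoin the `p i` with `a i = k + 1`. Contraction does not
lower dimension divided by `n.choose k` (local LYM, applied to colex leading terms), and the `q i`
show that the new `p i` are independent modulo the contracted space. In degree `n` the dimension is
at most 1. -/

/-! ### Generic projections -/

/-- Finitely many subspaces of dimension at most `n` can be mapped injectively to `ℝⁿ` by one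
linear map. -/
theorem exists_linearMap_disjoint_ker {ι : Type*} [Finite ι] (n d : ℕ) :
    ∀ (V : Type) [AddCommGroup V] [Module ℝ V] [FiniteDimensional ℝ V]
      (U : ι → Submodule ℝ V), finrank ℝ V ≤ n + d → (∀ i, finrank ℝ (U i) ≤ n) →
      ∃ f : V →ₗ[ℝ] (Fin n → ℝ), ∀ i, Disjoint (U i) (LinearMap.ker f) := by
  induction d with
  | zero =>
    intro V _ _ _ U hV _
    obtain ⟨f, hf⟩ := (finrank_le_iff_exists_linearMap (R := ℝ) (M := V)
      (M' := Fin n → ℝ)).1 (by simpa using hV)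
    exact ⟨f, fun i => by rw [LinearMap.ker_eq_bot.2 hf]; exact disjoint_bot_right⟩
  | succ d ih =>
    intro V _ _ _ U hV hU
    by_cases hle : finrank ℝ V ≤ n + d
    · exact ih V U hle hU
    -- A real space is not a finite union of proper subspaces, so some line avoids every `U i` and
    -- can be quotiented out.
    have hcov : ⋃ i, (U i : Set V) ≠ Set.univ := by
      intro h
      obtain ⟨i, hi⟩ := Subspace.exists_eq_top_of_iUnion_eq_univ h
      have := hU i
      rw [hi, finrank_top] at this
      omega
    obtain ⟨v, hv⟩ := (Set.ne_univ_iff_exists_notMem _).1 hcov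
    simp only [Set.mem_iUnion, SetLike.mem_coe, not_exists] at hv
    by_cases hv0 : v = 0
    -- Zero lies in every `U i`, so here `ι` is empty.
    · exact ⟨0, fun i => (hv i (hv0 ▸ zero_mem _)).elim⟩
    obtain ⟨g, hg⟩ := ih (V ⧸ ℝ ∙ v) (fun i => (U i).map (ℝ ∙ v).mkQ)
      (by
        have := Submodule.finrank_quotient_add_finrank (ℝ ∙ v)
        rw [finrank_span_singleton hv0] at this
        omega)
      (fun i => (Submodule.finrank_map_le _ _).trans (hU i))
    refine ⟨g ∘ₗ (ℝ ∙ v).mkQ, fun i => Submodule.disjoint_def.2 fun x hx hxk => ?_⟩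
    have h0 : (ℝ ∙ v).mkQ x = 0 :=
      Submodule.disjoint_def.1 (hg i) _ (Submodule.mem_map_of_mem hx) (by simpa using hxk)
    rw [Submodule.mkQ_apply, Submodule.Quotient.mk_eq_zero, Submodule.mem_span_singleton] at h0
    obtain ⟨c, rfl⟩ := h0
    by_contra hne
    have hc : c ≠ 0 := fun h => hne (by simp [h])
    exact hv i (by simpa [smul_smul, hc] using (U i).smul_mem c⁻¹ hx)

/-! ### Leading terms -/

section Leading
variable {σ τ : Type*} [Fintype σ] [LinearOrder τ] (o : σ → τ)

open scoped Classical in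
/-- The positions of the leading terms, with respect to the order pulled back along `o`,
of the elements of a space of functions. -/
noncomputable def leadingTerms (W : Submodule ℝ (σ → ℝ)) : Finset σ :=
  {s | ∃ f ∈ W, f s ≠ 0 ∧ ∀ t, o s < o t → f t = 0}

variable {o}

theorem mem_leadingTerms {W : Submodule ℝ (σ → ℝ)} {s : σ} :
    s ∈ leadingTerms o W ↔ ∃ f ∈ W, f s ≠ 0 ∧ ∀ t, o s < o t → f t = 0 := by
  simp [leadingTerms]

theorem exists_leading {f : σ → ℝ} (hf : f ≠ 0) :
    ∃ s, f s ≠ 0 ∧ ∀ t, o s < o t → f t = 0 := by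
  classical
  obtain ⟨s₀, hs₀⟩ := Function.ne_iff.1 hf
  obtain ⟨s, hs, hmax⟩ := exists_max_image ({s | f s ≠ 0} : Finset σ) o ⟨s₀, by simpa using hs₀⟩
  refine ⟨s, by simpa using hs, fun t ht => ?_⟩
  by_contra h
  exact (hmax t (by simpa using h)).not_gt ht

theorem finrank_le_card_leadingTerms (W : Submodule ℝ (σ → ℝ)) :
    finrank ℝ W ≤ #(leadingTerms o W) := by
  have : Function.Injective
      ((LinearMap.funLeft ℝ ℝ (Subtype.val : leadingTerms o W → σ)) ∘ₗ W.subtype) := by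
    rw [← LinearMap.ker_eq_bot, LinearMap.ker_eq_bot']
    rintro ⟨f, hf⟩ h
    by_contra hne
    obtain ⟨s, hs, hmax⟩ := exists_leading (o := o) (f := f) (fun h => hne (Subtype.ext h))
    exact hs (congrFun h ⟨s, mem_leadingTerms.2 ⟨f, hf, hs, hmax⟩⟩)
  simpa using LinearMap.finrank_le_finrank_of_injective this

/-- Functions with distinct leading positions form a triangular system, hence are independent. -/
theorem card_leadingTerms_le_finrank (ho : Function.Injective o) (W : Submodule ℝ (σ → ℝ)) :
    #(leadingTerms o W) ≤ finrank ℝ W := by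
  classical
  choose f hfW hf hmax using fun s : leadingTerms o W => mem_leadingTerms.1 s.2
  have hli : LinearIndependent ℝ (fun s => (⟨f s, hfW s⟩ : W)) := by
    rw [Fintype.linearIndependent_iff]
    intro g hg
    by_contra! hne
    obtain ⟨s, hs, hs'⟩ := exists_leading (o := fun s : leadingTerms o W => o s)
      (f := g) (Function.ne_iff.2 hne)
    have h1 := congrFun (congrArg Subtype.val hg) s
    simp only [AddSubmonoidClass.coe_finsetSum, SetLike.mk_smul_mk, Finset.sum_apply,
      Pi.smul_apply, smul_eq_mul, ZeroMemClass.coe_zero, Pi.zero_apply] at h1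
    rw [sum_eq_single s] at h1
    · exact mul_ne_zero hs (hf s) h1
    · intro t _ hts
      rcases lt_trichotomy (o s) (o t) with h | h | h
      · rw [hs' t h, zero_mul]
      · exact (hts (Subtype.ext (ho h)).symm).elim
      · rw [hmax t s h, mul_zero]
    · simp
  simpa using hli.fintype_card_le_finrank

end Leading

/-! ### Contraction operators on functions of finite sets -/

section Contraction
variable {n : ℕ}

/-- The sign of moving `j` past the smaller elements of `T`. -/
def contractSign (j : Fin n) (T : Finset (Fin n)) : ℝ := (-1) ^ #{i ∈ T | i < j}

theorem contractSign_ne_zero (j : Fin n) (T : Finset (Fin n)) : contractSign j T ≠ 0 :=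
  pow_ne_zero _ (by norm_num)

/-- The operator on functions of subsets of `Fin n` that removes `j`, up to sign. -/
def contract (j : Fin n) : End ℝ (Finset (Fin n) → ℝ) where
  toFun f T := if j ∈ T then 0 else contractSign j T * f (insert j T)
  map_add' f g := by ext T; by_cases h : j ∈ T <;> simp [h, mul_add]
  map_smul' c f := by ext T; by_cases h : j ∈ T <;> simp [h, mul_left_comm]

theorem contract_apply (j : Fin n) (f : Finset (Fin n) → ℝ) (T : Finset (Fin n)) :
    contract j f T = if j ∈ T then 0 else contractSign j T * f (insert j T) := rfl

theorem contractSign_insert_of_lt {i j : Fin n} {T : Finset (Fin n)} (h : i < j) (hi : i ∉ T) :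
    contractSign j (insert i T) = -contractSign j T := by
  rw [contractSign, filter_insert, if_pos h, card_insert_of_notMem (by simp [hi]), pow_succ,
    contractSign]
  ring

theorem contractSign_insert_of_not_lt {i j : Fin n} {T : Finset (Fin n)} (h : ¬ i < j) :
    contractSign j (insert i T) = contractSign j T := by
  rw [contractSign, filter_insert, if_neg h, contractSign]

theorem contract_mul_contract_of_lt {i j : Fin n} (hij : i < j) :
    contract i * contract j = -(contract j * contract i) := by
  refine LinearMap.ext fun f => funext fun T => ?_
  simp only [Module.End.mul_apply, LinearMap.neg_apply, Pi.neg_apply, contract_apply, mem_insert,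
    hij.ne, hij.ne', false_or]
  by_cases hi : i ∈ T <;> by_cases hj : j ∈ T <;> simp only [hi, hj, if_true, if_false, mul_zero,
    neg_zero]
  rw [contractSign_insert_of_lt hij hi, contractSign_insert_of_not_lt hij.not_gt,
    Finset.insert_comm]
  ring

theorem contract_mul_contract (i j : Fin n) :
    contract i * contract j = -(contract j * contract i) := by
  rcases lt_trichotomy i j with h | rfl | h
  · exact contract_mul_contract_of_lt h
  · have : contract i * contract i = 0 := by
      refine LinearMap.ext fun f => funext fun T => ?_
      simp [contract_apply]
    simp [this]
  · rw [contract_mul_contract_of_lt h, neg_neg]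

/-- The operator attached to a vector of `ℝⁿ`. -/
noncomputable def contractVec (n : ℕ) : (Fin n → ℝ) →ₗ[ℝ] End ℝ (Finset (Fin n) → ℝ) :=
  Fintype.linearCombination ℝ contract

theorem contractVec_apply (v : Fin n → ℝ) : contractVec n v = ∑ j, v j • contract j := rfl

theorem contractVec_mul_self (v : Fin n → ℝ) : contractVec n v * contractVec n v = 0 := by
  have h : contractVec n v * contractVec n v = -(contractVec n v * contractVec n v) := by
    conv_rhs => rw [contractVec_apply, sum_mul_sum, sum_comm]
    conv_lhs => rw [contractVec_apply, sum_mul_sum]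
    rw [← sum_neg_distrib]
    refine sum_congr rfl fun i _ => ?_
    rw [← sum_neg_distrib]
    refine sum_congr rfl fun j _ => ?_
    rw [smul_mul_smul_comm, smul_mul_smul_comm, contract_mul_contract, smul_neg, mul_comm]
  have h2 := add_eq_zero_iff_eq_neg.2 h
  rwa [← two_smul ℝ, smul_eq_zero_iff_right two_ne_zero] at h2

/-- The action of the exterior algebra of `ℝⁿ` on functions of subsets of `Fin n`. -/
noncomputable def exteriorAction (n : ℕ) :
    ExteriorAlgebra ℝ (Fin n → ℝ) →ₐ[ℝ] End ℝ (Finset (Fin n) → ℝ) :=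
  ExteriorAlgebra.lift ℝ ⟨contractVec n, contractVec_mul_self⟩

@[simp]
theorem exteriorAction_ι (v : Fin n → ℝ) :
    exteriorAction n (ExteriorAlgebra.ι ℝ v) = contractVec n v :=
  ExteriorAlgebra.lift_ι_apply _ _ _ _

theorem contractVec_single (j : Fin n) : contractVec n (Pi.single j 1) = contract j := by
  simp [contractVec]

theorem exists_ιMulti_mul_ι {M : Type*} [AddCommGroup M] [Module ℝ M] (k : ℕ) (v : Fin k → M)
    (w : M) : ∃ c : ℝ, ExteriorAlgebra.ιMulti ℝ k v * ExteriorAlgebra.ι ℝ w =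
      c • (ExteriorAlgebra.ι ℝ w * ExteriorAlgebra.ιMulti ℝ k v) := by
  induction k with
  | zero => exact ⟨1, by simp⟩
  | succ k ih =>
    obtain ⟨c, hc⟩ := ih (Matrix.vecTail v)
    refine ⟨-c, ?_⟩
    have := eq_neg_of_add_eq_zero_left (ExteriorAlgebra.ι_add_mul_swap (R := ℝ) (v 0) w)
    rw [ExteriorAlgebra.ιMulti_succ_apply, mul_assoc, hc, mul_smul_comm, ← mul_assoc, this,
      neg_mul, mul_assoc, smul_neg, neg_smul]

/-- Ensures that a function killed by the operator of a multivector stays killed after further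
contraction. -/
theorem exists_exteriorAction_mul_contract (k : ℕ) (v : Fin k → Fin n → ℝ) (j : Fin n) :
    ∃ c : ℝ, exteriorAction n (ExteriorAlgebra.ιMulti ℝ k v) * contract j =
      c • (contract j * exteriorAction n (ExteriorAlgebra.ιMulti ℝ k v)) := by
  obtain ⟨c, hc⟩ := exists_ιMulti_mul_ι k v (Pi.single j 1)
  refine ⟨c, ?_⟩
  simpa [contractVec_single] using congrArg (exteriorAction n) hc

theorem contract_prod_apply_ne_zero (l : List (Fin n)) (hl : l.Nodup) :
    (l.map contract).prod (Pi.single univ 1) (univ \ l.toFinset) ≠ 0 := by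
  induction l with
  | nil => simp
  | cons j l ih =>
    obtain ⟨hj, hl⟩ := List.nodup_cons.1 hl
    rw [List.map_cons, List.prod_cons, Module.End.mul_apply, contract_apply, if_neg (by simp)]
    refine mul_ne_zero (contractSign_ne_zero _ _) ?_
    convert ih hl using 2
    ext i
    by_cases h : i = j <;> simp [h, hj]

theorem exteriorAction_ιMulti_apply_ne_zero {m : ℕ} (hm : m = n) (v : Fin m → Fin n → ℝ)
    (hv : LinearIndependent ℝ v) :
    exteriorAction n (ExteriorAlgebra.ιMulti ℝ m v) (Pi.single univ 1) ≠ 0 := by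
  subst hm
  let g : (Fin m → ℝ) [⋀^Fin m]→ₗ[ℝ] ℝ :=
    ((LinearMap.proj ∅ ∘ₗ LinearMap.applyₗ (Pi.single univ 1)) ∘ₗ
      (exteriorAction m).toLinearMap).compAlternatingMap (ExteriorAlgebra.ιMulti ℝ m)
  -- A nonzero alternating form in top degree is nonzero on every basis, so the standard basis is
  -- enough.
  have hg : g ≠ 0 := by
    intro h
    have h1 : exteriorAction m (ExteriorAlgebra.ιMulti ℝ m (fun i => Pi.single i 1))
        (Pi.single univ 1) ∅ = 0 := AlternatingMap.congr_fun h _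
    have h2 := contract_prod_apply_ne_zero (List.finRange m) (List.nodup_finRange m)
    refine h2 ?_
    have h3 : exteriorAction m (ExteriorAlgebra.ιMulti ℝ m (fun i => Pi.single i 1)) =
        ((List.finRange m).map contract).prod := by
      rw [ExteriorAlgebra.ιMulti_apply, map_list_prod, List.map_ofFn, List.ofFn_eq_map]
      simp [Function.comp_def, contractVec_single]
    rw [← h3]
    simpa using h1
  have hb := (g.map_basis_ne_zero_iff
    (basisOfLinearIndependentOfCardEqFinrank' v hv (by simp))).2 hg
  intro h
  apply hb
  simp [g, h]

theorem exteriorAction_ιMulti_apply_support (k : ℕ) (v : Fin k → Fin n → ℝ) :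
    ∀ T, exteriorAction n (ExteriorAlgebra.ιMulti ℝ k v) (Pi.single univ 1) T ≠ 0 →
      #T + k = n := by
  induction k with
  | zero =>
    intro T hT
    have : T = univ := by
      by_contra h
      exact hT (by simp [h])
    simp [this]
  | succ k ih =>
    intro T hT
    rw [ExteriorAlgebra.ιMulti_succ_apply, map_mul, exteriorAction_ι, contractVec_apply,
      Module.End.mul_apply, LinearMap.sum_apply, Finset.sum_apply] at hT
    obtain ⟨j, -, hj⟩ := exists_ne_zero_of_sum_ne_zero hT
    rw [LinearMap.smul_apply, Pi.smul_apply, contract_apply] at hj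
    split_ifs at hj with hjT
    · simp at hj
    · have := ih _ _ (right_ne_zero_of_mul (right_ne_zero_of_mul hj))
      rw [card_insert_of_notMem hjT] at this
      omega

/-! ### Shadows of spaces of functions -/

/-- The span of the images of `W` under the contractions. -/
noncomputable def contractSpan (W : Submodule ℝ (Finset (Fin n) → ℝ)) :
    Submodule ℝ (Finset (Fin n) → ℝ) := ⨆ j, W.map (contract j)

/-- Deleting a common element preserves colex comparisons, so if `f` leads at `S ∋ j` then `contract
j f` leads at `S.erase j`. -/
theorem shadow_leadingTerms_subset (W : Submodule ℝ (Finset (Fin n) → ℝ)) :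
    ∂ (leadingTerms toColex W) ⊆ leadingTerms toColex (contractSpan W) := by
  intro T hT
  obtain ⟨S, hS, j, hj, rfl⟩ := mem_shadow_iff.1 hT
  obtain ⟨f, hfW, hf, hmax⟩ := mem_leadingTerms.1 hS
  refine mem_leadingTerms.2 ⟨contract j f,
    Submodule.mem_iSup_of_mem j (Submodule.mem_map_of_mem hfW), ?_, fun T hT => ?_⟩
  · rw [contract_apply, if_neg (notMem_erase j S), insert_erase hj]
    exact mul_ne_zero (contractSign_ne_zero _ _) hf
  · rw [contract_apply]
    split_ifs with h
    · rfl
    rw [hmax, mul_zero]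
    rw [← Colex.toColex_sdiff_lt_toColex_sdiff (u := {j}) (by simpa using hj) (by simp)]
    rwa [sdiff_singleton_eq_erase, sdiff_singleton_eq_erase, erase_insert h]

/-- The local LYM inequality for spaces of functions supported on sets of one size. -/
theorem finrank_div_choose_le_contractSpan {k : ℕ} (hk : k < n)
    {W : Submodule ℝ (Finset (Fin n) → ℝ)} (hW : ∀ f ∈ W, ∀ T, f T ≠ 0 → #T + k = n) :
    (finrank ℝ W : ℝ) / n.choose k ≤ finrank ℝ (contractSpan W) / n.choose (k + 1) := by
  have hsized : (leadingTerms toColex W : Set (Finset (Fin n))).Sized (n - k) := by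
    intro T hT
    obtain ⟨f, hfW, hf, -⟩ := mem_leadingTerms.1 hT
    have := hW f hfW T hf
    omega
  -- The sets have size `n - k`, since `k` counts removed elements; symmetry of binomials restores
  -- `k`.
  have hlym := local_lubell_yamamoto_meshalkin_inequality_div (𝕜 := ℝ) (by omega) hsized
  rw [Fintype.card_fin, Nat.choose_symm hk.le, Nat.sub_sub, Nat.choose_symm hk] at hlym
  calc (finrank ℝ W : ℝ) / n.choose k
      ≤ #(leadingTerms toColex W) / n.choose k := by
        gcongr; exact finrank_le_card_leadingTerms W
    _ ≤ #(∂ (leadingTerms toColex W)) / n.choose (k + 1) := hlym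
    _ ≤ finrank ℝ (contractSpan W) / n.choose (k + 1) := by
        gcongr
        exact (card_le_card (shadow_leadingTerms_subset W)).trans
          (card_leadingTerms_le_finrank toColex.injective _)

end Contraction

/-! ### Dimension count through the degrees -/

theorem finrank_add_card_le_finrank_sup_span {ι M M' : Type*} [AddCommGroup M] [Module ℝ M]
    [FiniteDimensional ℝ M] [AddCommGroup M'] [Module ℝ M'] (D : Submodule ℝ M) (s : Finset ι)
    (p : ι → M) (q : ι → M →ₗ[ℝ] M') (hD : ∀ i ∈ s, ∀ x ∈ D, q i x = 0)
    (hne : ∀ i ∈ s, ∀ j ∈ s, i ≠ j → q i (p j) = 0) (hself : ∀ i ∈ s, q i (p i) ≠ 0) :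
    finrank ℝ D + #s ≤ finrank ℝ ↥(D ⊔ Submodule.span ℝ (p '' s)) := by
  classical
  -- Applying `q i` isolates the coefficient `c i`. This yields both independence and trivial
  -- intersection with `D`.
  have key : ∀ c : s → ℝ, ∑ i, c i • p i ∈ D → ∀ i, c i = 0 := by
    intro c hc i
    have h := hD i i.2 _ hc
    rw [map_sum, sum_eq_single i] at h
    · simpa [hself i i.2] using h
    · intro j _ hji
      rw [map_smul, hne i i.2 j j.2 (fun h => hji (Subtype.ext h).symm), smul_zero]
    · simp
  have hli : LinearIndependent ℝ (fun i : s => p i) :=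
    Fintype.linearIndependent_iff.2 fun c hc => key c (hc ▸ zero_mem _)
  have himg : p '' s = Set.range (fun i : s => p i) := by
    rw [Set.image_eq_range]; rfl
  have hdis : D ⊓ Submodule.span ℝ (p '' s) = ⊥ := by
    rw [← disjoint_iff, Submodule.disjoint_def, himg]
    intro x hxD hx
    obtain ⟨c, rfl⟩ := (Submodule.mem_span_range_iff_exists_fun ℝ).1 hx
    exact sum_eq_zero fun i _ => by rw [key c hxD i, zero_smul]
  have h := Submodule.finrank_sup_add_finrank_inf_eq D (Submodule.span ℝ (p '' s))
  rw [hdis, finrank_bot, add_zero] at h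
  rw [h, himg, finrank_span_eq_card hli, Fintype.card_coe]

/-- The weighted two families inequality in terms of vectors and operators. -/
theorem sum_one_div_choose_le_one {n m : ℕ} (a : Fin m → ℕ) (ha0 : ∀ i, 0 < a i)
    (han : ∀ i, a i ≤ n) (p : Fin m → Finset (Fin n) → ℝ) (q : Fin m → End ℝ (Finset (Fin n) → ℝ))
    (hp : ∀ i T, p i T ≠ 0 → #T + a i = n)
    (hq : ∀ i j, ∃ c : ℝ, q i * contract j = c • (contract j * q i))
    (hne : ∀ i j, i ≠ j → q i (p j) = 0) (hself : ∀ i, q i (p i) ≠ 0) :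
    ∑ i, (1 : ℝ) / n.choose (a i) ≤ 1 := by
  have step : ∀ k ≤ n, ∃ W : Submodule ℝ (Finset (Fin n) → ℝ),
      (∀ f ∈ W, ∀ T, f T ≠ 0 → #T + k = n) ∧ (∀ i, k < a i → ∀ f ∈ W, q i f = 0) ∧
      ∑ i with a i ≤ k, (1 : ℝ) / n.choose (a i) ≤ finrank ℝ W / n.choose k := by
    intro k
    induction k with
    | zero =>
      intro _
      refine ⟨⊥, by simp, by simp, ?_⟩
      rw [filter_false_of_mem (fun i _ => (ha0 i).not_ge)]
      simp
    | succ k ih =>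
      intro hk
      obtain ⟨W, hsupp, hkill, hdim⟩ := ih (by omega)
      -- `q i` commutes with contractions up to a scalar, so vanishing on `W` passes to the
      -- contracted space.
      have hDkill : ∀ i, k < a i → contractSpan W ≤ LinearMap.ker (q i) := by
        intro i hi
        refine iSup_le fun j => ?_
        rintro _ ⟨f, hf, rfl⟩
        obtain ⟨c, hc⟩ := hq i j
        have := LinearMap.congr_fun hc f
        simpa [hkill i hi f hf] using this
      refine ⟨contractSpan W ⊔ Submodule.span ℝ (p '' ({i | a i = k + 1} : Finset (Fin m))),
        ?_, ?_, ?_⟩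
      · let E : Submodule ℝ (Finset (Fin n) → ℝ) :=
          { carrier := {f | ∀ T, f T ≠ 0 → #T + (k + 1) = n}
            zero_mem' := by simp
            add_mem' := by
              intro f g hf hg T hT
              by_cases h : f T = 0
              · exact hg T (by simpa [h] using hT)
              · exact hf T h
            smul_mem' := by
              intro c f hf T hT
              exact hf T (right_ne_zero_of_mul hT) }
        suffices h : contractSpan W ⊔ Submodule.span ℝ
            (p '' ({i | a i = k + 1} : Finset (Fin m))) ≤ E from fun f hf => h hf
        refine sup_le (iSup_le fun j => ?_) (Submodule.span_le.2 ?_)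
        · rintro _ ⟨f, hf, rfl⟩ T hT
          rw [contract_apply] at hT
          split_ifs at hT with h
          · exact (hT rfl).elim
          · have := hsupp f hf _ (right_ne_zero_of_mul hT)
            rw [card_insert_of_notMem h] at this
            omega
        · rintro _ ⟨i, hi, rfl⟩ T hT
          have := hp i T hT
          simp only [coe_filter, mem_univ, true_and, Set.mem_ofPred_eq] at hi
          omega
      · intro i hi
        suffices h : contractSpan W ⊔ Submodule.span ℝ
            (p '' ({i | a i = k + 1} : Finset (Fin m))) ≤ LinearMap.ker (q i) from
          fun f hf => h hf
        refine sup_le (hDkill i (by omega)) (Submodule.span_le.2 ?_)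
        rintro _ ⟨j, hj, rfl⟩
        simp only [coe_filter, mem_univ, true_and, Set.mem_ofPred_eq] at hj
        exact hne i j (by rintro rfl; omega)
      · have h1 := finrank_add_card_le_finrank_sup_span (contractSpan W)
          ({i | a i = k + 1} : Finset (Fin m)) p q
          (fun i hi x hx => hDkill i (by simp at hi; omega) hx)
          (fun i _ j _ => hne i j) (fun i _ => hself i)
        have h2 := finrank_div_choose_le_contractSpan (Nat.lt_of_succ_le hk) hsupp
        have hunion : ({i | a i ≤ k + 1} : Finset (Fin m)) =
            ({i | a i ≤ k} : Finset (Fin m)) ∪ ({i | a i = k + 1} : Finset (Fin m)) := by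
          ext i
          simp only [mem_filter, mem_univ, true_and, mem_union]
          omega
        rw [hunion, sum_union (disjoint_filter.2 fun i _ h h' => by omega)]
        have h3 : ∑ i with a i = k + 1, (1 : ℝ) / n.choose (a i) =
            #({i | a i = k + 1} : Finset (Fin m)) / n.choose (k + 1) := by
          rw [sum_congr rfl (g := fun _ => (1 : ℝ) / n.choose (k + 1))
            (fun i hi => by rw [(mem_filter.1 hi).2])]
          simp [div_eq_mul_inv]
        rw [h3]
        calc _ ≤ (finrank ℝ (contractSpan W) : ℝ) / n.choose (k + 1) +
              #({i | a i = k + 1} : Finset (Fin m)) / n.choose (k + 1) := by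
              gcongr; exact hdim.trans h2
          _ ≤ _ := by
              rw [← add_div]
              gcongr
              exact_mod_cast h1
  obtain ⟨W, hsupp, -, hdim⟩ := step n le_rfl
  rw [filter_true_of_mem (fun i _ => han i), Nat.choose_self, Nat.cast_one, div_one] at hdim
  refine hdim.trans ?_
  have hsub : leadingTerms toColex W ⊆ {∅} := by
    intro T hT
    obtain ⟨f, hfW, hf, -⟩ := mem_leadingTerms.1 hT
    have := hsupp f hfW T hf
    simpa using (show #T = 0 by omega)
  exact_mod_cast (finrank_le_card_leadingTerms W).trans (card_le_card hsub)

/-! ### Application to subspaces -/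

theorem linearIndependent_append {R M : Type*} [Ring R] [AddCommGroup M] [Module R M] {k l : ℕ}
    (a : Fin k → M) (b : Fin l → M) :
    LinearIndependent R (Fin.append a b) ↔ LinearIndependent R (Sum.elim a b) := by
  rw [← linearIndependent_equiv finSumFinEquiv]
  congr! 1
  ext (i | i) <;> simp

theorem corollary3p9 (n N m : ℕ) (hn : 2 ≤ n)
    (A B : Fin m → Submodule ℝ (Fin N → ℝ))
    (hA : ∀ i, A i ≠ ⊥) (hB : ∀ i, B i ≠ ⊥)
    (hsum : ∀ i, Module.finrank ℝ (A i) + Module.finrank ℝ (B i) = n)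
    (hdisj : ∀ i, Module.finrank ℝ ↥(A i ⊓ B i) = 0)
    (hcross : ∀ i j, i ≠ j → 0 < Module.finrank ℝ ↥(A i ⊓ B j)) :
    ∑ i, (1 : ℝ) / (n.choose (Module.finrank ℝ (A i)) : ℝ) ≤ 1 := by
  obtain ⟨f, hf⟩ := exists_linearMap_disjoint_ker n N (Fin N → ℝ) (fun i => A i ⊔ B i) (by simp)
    (fun i => (Submodule.finrank_add_le_finrank_add_finrank _ _).trans (hsum i).le)
  let basisOf : ∀ U : Submodule ℝ (Fin N → ℝ), Fin (finrank ℝ U) → Fin N → ℝ :=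
    fun U i => finBasis ℝ U i
  have hspan : ∀ U, Submodule.span ℝ (Set.range (basisOf U)) = U := by
    intro U
    have : basisOf U = U.subtype ∘ finBasis ℝ U := rfl
    rw [this, Set.range_comp, ← Submodule.map_span, (finBasis ℝ U).span_eq, Submodule.map_top,
      Submodule.range_subtype]
  have hli : ∀ U, LinearIndependent ℝ (basisOf U) := fun U =>
    (finBasis ℝ U).linearIndependent.map' U.subtype U.ker_subtype
  let vec := fun U => f ∘ basisOf U
  have happ : ∀ i j, exteriorAction n (ExteriorAlgebra.ιMulti ℝ _ (vec (B i)))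
      (exteriorAction n (ExteriorAlgebra.ιMulti ℝ _ (vec (A j))) (Pi.single univ 1)) =
      exteriorAction n (ExteriorAlgebra.ιMulti ℝ _ (Fin.append (vec (B i)) (vec (A j))))
        (Pi.single univ 1) := by
    intro i j
    rw [← ExteriorAlgebra.ιMulti_mul_ιMulti, map_mul, Module.End.mul_apply]
  have helim : ∀ i j, Sum.elim (vec (B i)) (vec (A j)) =
      f ∘ Sum.elim (basisOf (B i)) (basisOf (A j)) := fun i j => (Sum.comp_elim _ _ _).symm
  refine sum_one_div_choose_le_one (fun i => finrank ℝ (A i))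
    (fun i => Nat.pos_of_ne_zero fun h => hA i (Submodule.finrank_eq_zero.1 h))
    (fun i => by have := hsum i; omega)
    (fun i => exteriorAction n (ExteriorAlgebra.ιMulti ℝ _ (vec (A i))) (Pi.single univ 1))
    (fun i => exteriorAction n (ExteriorAlgebra.ιMulti ℝ _ (vec (B i))))
    (fun i => exteriorAction_ιMulti_apply_support _ _)
    (fun i j => exists_exteriorAction_mul_contract _ _ j) (fun i j hij => ?_) (fun i => ?_)
  -- `B i` meets `A j`, so the joined bases are dependent and their wedge vanishes.
  · rw [happ, AlternatingMap.map_linearDependent, map_zero, LinearMap.zero_apply]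
    rw [linearIndependent_append, helim]
    intro h
    have hd := (linearIndependent_sum.1 h.of_comp).2.2
    rw [Sum.elim_comp_inl, Sum.elim_comp_inr, hspan, hspan] at hd
    have := hcross j i hij.symm
    rw [hd.symm.eq_bot, finrank_bot] at this
    exact this.false
  · rw [happ]
    refine exteriorAction_ιMulti_apply_ne_zero (by have := hsum i; omega) _ ?_
    rw [linearIndependent_append, helim]
    have hd : Disjoint (B i) (A i) := (disjoint_iff.2 (Submodule.finrank_eq_zero.1 (hdisj i))).symm
    refine (LinearIndependent.sum_type (hli _) (hli _) (by rwa [hspan, hspan])).map ?_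
    rw [Set.Sum.elim_range, Submodule.span_union, hspan, hspan, sup_comm]
    exact hf i
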